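/- **Setting.** Let $T$ be an $\omega$-stable theory: a complete first-order theory with infinite models, in a countable language, such that for every model $\mathcal N\models T$, every $A\subseteq N$ with $|A|=\aleph_0$ and every $n\ge 1$, there are exactly $\aleph_0$ complete $n$-types over $A$. Let $\mathcal M\models T$, and let $\mathfrak M\succeq\mathcal M$ be a monster model of $T$ (only $\aleph_0$-saturation of $\mathfrak M$ is needed; every model of $T$ has an $\aleph_0$-saturated elementary extension, and this is part of the claim). Morley rank $\mathrm{RM}$ is computed in $\mathfrak M$, and the rank of a type is the least rank of a formula in it. For $A\subseteq B$, a complete type $q$ over $B$ is a non-forking extension of the type $p$ over $A$ if $p\subseteq q$ and $\mathrm{RM}(q)=\mathrm{RM}(p)$. For $A,B,C\subseteq\mathfrak M$, $A$ is independent from $B$ over $C$, written $A\mathrel{\perp}_C B$, if for every finite tuple $\vec a$ of elements of $A$ the type $\mathrm{tp}(\vec a/C\cup B)$ is a non-forking extension of $\mathrm{tp}(\vec a/C)$. An element $b\in M$ lies in $\mathrm{acl}(A)$, for $A\subseteq M$, if it belongs to a finite subset of $M$ definable with parameters from $A$. A dependence structure is a non-empty set $I$ with a binary relation $\Rightarrow$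 between finite subsets of $I$ such that (D1) $x\Rightarrow x$; (D2) if $x\Rightarrow y\cup z$ then $x\cup u\Rightarrow y$; (D3) if $x\Rightarrow y$ and $y\Rightarrow z$ then $x\Rightarrow z$; (D4) if $x\Rightarrow y$ and $x\Rightarrow z$ then $x\Rightarrow y\cup z$. Let $V$ be a set of variables. A dependence atom $=\!(\vec x,\vec y)$ is a pair of finite sequences from $V$ with $\vec y\neq\emptyset$ if $\vec x\ne\emptyset$. For a set $\Sigma$ of atoms and an atom $\phi$, $\Sigma\vdash_{\mathcal D}\phi$ means that $\phi$ is derivable from $\Sigma$, within the set of dependence atoms, by the rules (juxtaposition denotes concatenation) - (a$_1$) $=\!(\vec x,\vec x)$, including $=\!(\emptyset,\emptyset)$; - (b$_1$) from $=\!(\vec x,\vec y\vec z)$ infer $=\!(\vec x\vec u,\vec y)$; - (c$_1$) from $=\!(\vec x,\vec y)$ and $=\!(\vec y,\vec z)$ infer $=\!(\vec x,\vec z)$; - (d$_1$) from $=\!(\vec x,\vec y)$ and $=\!(\vec x,\vec v)$ infer $=\!(\vec x,\vec y\vec v)$; - (e$_1$) from $=\!(\vec x,\vec y)$ infer $=\!(\vec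 z,\vec y)$ if $\vec z$ is a permutation of $\vec x$. An assignment $s:V\to I$ satisfies $=\!(\vec x,\vec y)$ in $(I,\Rightarrow)$ if $s(\vec x)\Rightarrow s(\vec y)$, where $s(\vec x)$ is the finite set of values of $\vec x$ under $s$. For a class $\mathbf C$ of dependence structures, $\Sigma\models_{\mathbf C}\phi$ means that every assignment into a structure in $\mathbf C$ that satisfies all atoms in $\Sigma$ also satisfies $\phi$. **Theorem.** (1) For all finite $a,b\subseteq M$: $b\mathrel{\perp}_a b$ if and only if every element of $b$ lies in $\mathrm{acl}(a)$. (2) The relation $x\Rightarrow y :\iff y\mathrel{\perp}_x y$ between finite subsets of $M$ makes $M$ a dependence structure, the forking dependence structure $\mathcal D_{\mathcal M}$. If $\mathbf C$ is a class of dependence structures with $\mathcal D_{\mathcal M}\in\mathbf C$, and $\emptyset\neq\mathrm{acl}(\emptyset)\neq M$, then for every set $V$ of variables, every set $\Sigma$ of dependence atoms over $V$ and every dependence atom $\phi$ over $V$, $$\Sigma\vdash_{\mathcal D}\phi\iff\Sigma\models_{\mathbf C}\phi .$$ -/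

import Mathlib

universe u v w w' x

open FirstOrder FirstOrder.Language

namespace AtomicDependence

noncomputable section

/-! ### Dependence atoms, derivations, dependence structures -/

/-- A dependence atom `=(x, y)` over the set `V` of variables: a pair of finite sequences of
variables such that `y` is non-empty whenever `x` is. -/
structure DepAtom (V : Type x) where
  lhs : List V
  rhs : List V
  rhs_ne : lhs ≠ [] → rhs ≠ []

/-- Derivability `S ⊢ φ` by the rules (a1)–(e1). All sequences occurring in a derivation form
dependence atoms (this is only a restriction in the second rule). -/
inductive Derivable {V : Type x} (S : Set (DepAtom V)) : DepAtom V → Prop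
  | hyp {φ : DepAtom V} : φ ∈ S → Derivable S φ
  | a1 (x : List V) : Derivable S ⟨x, x, id⟩
  | b1 {x y z u : List V} (h : x ≠ [] → y ++ z ≠ []) (h' : x ++ u ≠ [] → y ≠ []) :
      Derivable S ⟨x, y ++ z, h⟩ → Derivable S ⟨x ++ u, y, h'⟩
  | c1 {x y z : List V} (h₁ : x ≠ [] → y ≠ []) (h₂ : y ≠ [] → z ≠ []) (h' : x ≠ [] → z ≠ []) :
      Derivable S ⟨x, y, h₁⟩ → Derivable S ⟨y, z, h₂⟩ → Derivable S ⟨x, z, h'⟩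
  | d1 {x y v : List V} (h₁ : x ≠ [] → y ≠ []) (h₂ : x ≠ [] → v ≠ []) (h' : x ≠ [] → y ++ v ≠ []) :
      Derivable S ⟨x, y, h₁⟩ → Derivable S ⟨x, v, h₂⟩ → Derivable S ⟨x, y ++ v, h'⟩
  | e1 {x y z : List V} (h : x ≠ [] → y ≠ []) (h' : z ≠ [] → y ≠ []) :
      z.Perm x → Derivable S ⟨x, y, h⟩ → Derivable S ⟨z, y, h'⟩

open Classical in
/-- The axioms D1–D4 for a binary relation between finite subsets of `I`. -/
structure IsDependenceRelation {I : Type w} (R : Finset I → Finset I → Prop) : Prop where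
  d1 : ∀ x, R x x
  d2 : ∀ x y z u, R x (y ∪ z) → R (x ∪ u) y
  d3 : ∀ x y z, R x y → R y z → R x z
  d4 : ∀ x y z, R x y → R x z → R x (y ∪ z)

/-- A dependence structure `(I, ⇒)`. -/
structure DependenceStructure where
  I : Type w
  [nonempty : Nonempty I]
  rel : Finset I → Finset I → Prop
  isDep : IsDependenceRelation rel

open Classical in
/-- `D ⊨ₛ =(x, y)`: the finite sets `s(x)`, `s(y)` of values satisfy `s(x) ⇒ s(y)`. -/
def DependenceStructure.Satisfies {V : Type x} (D : DependenceStructure.{w}) (s : V → D.I)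
    (φ : DepAtom V) : Prop :=
  D.rel (φ.lhs.map s).toFinset (φ.rhs.map s).toFinset

/-- `S ⊨_C φ`. -/
def Entails {V : Type x} (C : Set DependenceStructure.{w}) (S : Set (DepAtom V))
    (φ : DepAtom V) : Prop :=
  ∀ D ∈ C, ∀ s : V → D.I, (∀ ψ ∈ S, D.Satisfies s ψ) → D.Satisfies s φ

/-! ### Model theory: algebraic closure, ω-stability, saturation -/

/-- The algebraic closure of `A` in `M`: the union of the finite subsets of `M` which are
definable with parameters from `A`. -/
def acl (L : FirstOrder.Language.{u, v}) {M : Type w} [L.Structure M] (A : Set M) : Set M :=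
  {b | ∃ X : Set M, A.Definable₁ L X ∧ X.Finite ∧ b ∈ X}

/-- The space of complete `n`-types over a subset `A` of the structure `M`. -/
abbrev TypesOver (L : FirstOrder.Language.{u, v}) {M : Type w} [L.Structure M] (A : Set M) (n : ℕ) :=
  (L[[A]].completeTheory M).CompleteType (Fin n)

/-- The type `tp(a/A)` of a finite tuple over `A`. -/
def tp (L : FirstOrder.Language.{u, v}) {M : Type w} [L.Structure M] [Nonempty M] (A : Set M) {n : ℕ}
    (a : Fin n → M) : TypesOver L A n :=
  (L[[A]].completeTheory M).typeOf a

/-- `T` is an ω-stable theory: a complete theory with infinite models in a countable language such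
that there are exactly `ℵ₀` complete `n`-types (`n ≥ 1`) over any set of `ℵ₀` parameters in a
model of `T`. -/
structure IsOmegaStable {L : FirstOrder.Language.{u, v}} (T : L.Theory) : Prop where
  countable_language : L.card ≤ Cardinal.aleph0
  complete : T.IsComplete
  infinite_model : ∃ M : Theory.ModelType.{u, v, max u v} T, Infinite M
  card_types : ∀ (M : Theory.ModelType.{u, v, max u v} T) (A : Set M),
    Cardinal.mk A = Cardinal.aleph0 →
      ∀ n : ℕ, 1 ≤ n → Cardinal.mk (TypesOver L A n) = Cardinal.aleph0

/-- `M` is `ℵ₀`-saturated: all complete types over finite subsets of `M` are realized in `M`. -/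
def IsAleph0Saturated (L : FirstOrder.Language.{u, v}) (M : Type w) [L.Structure M] [Nonempty M] : Prop :=
  ∀ (A : Set M), A.Finite → ∀ (n : ℕ) (p : TypesOver L A n), ∃ a : Fin n → M, tp L A a = p

/-! ### Morley rank and forking

These are taken in a structure `U` which plays the role of the monster model; the definitions are
the usual ones as soon as `U` is `ℵ₀`-saturated. -/

section Forking

variable (L : FirstOrder.Language.{u, v}) {U : Type w} [L.Structure U]

/-- `RM(X) ≥ α` for a definable set `X`, by recursion on `α`:
`RM(X) ≥ 0` iff `X` is non-empty; `RM(X) ≥ α + 1` iff there are infinitely many pairwise disjoint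
definable (with parameters) subsets `Y₀, Y₁, …` of `X` with `RM(Yᵢ) ≥ α`; and for limit `δ`,
`RM(X) ≥ δ` iff `RM(X) ≥ β` for all `β < δ`. -/
def MorleyRankGE {n : ℕ} (α : Ordinal.{w}) : Set (Fin n → U) → Prop :=
  Ordinal.limitRecOn (motive := fun _ => Set (Fin n → U) → Prop) α
    (fun X => X.Nonempty)
    (fun _ ih X => ∃ Y : ℕ → Set (Fin n → U),
      (∀ i, (Set.univ : Set U).Definable L (Y i)) ∧ (∀ i, Y i ⊆ X) ∧
        (∀ i j, i ≠ j → Disjoint (Y i) (Y j)) ∧ ∀ i, ih (Y i))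
    (fun δ _ ih X => ∀ (β : Ordinal.{w}) (h : β < δ), ih β h X)

/-- The Morley rank of a definable set: `⊥` (that is, `-1`) for the empty set, an ordinal, or `⊤`
(that is, `∞`). -/
def morleyRank {n : ℕ} (X : Set (Fin n → U)) : WithBot (WithTop Ordinal.{w}) :=
  sSup {r | ∃ α : Ordinal.{w}, MorleyRankGE L α X ∧ r = ((α : WithTop Ordinal.{w}) : WithBot _)}

variable {L}

/-- The Morley rank of a type: the least Morley rank of a formula in it. -/
def typeRank {A : Set U} {n : ℕ} (p : TypesOver L A n) : WithBot (WithTop Ordinal.{w}) :=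
  sInf {r | ∃ φ : L[[A]].Formula (Fin n), Formula.equivSentence φ ∈ p ∧
    r = morleyRank L {a : Fin n → U | φ.Realize a}}

/-- For `A ⊆ B`, the type `q` over `B` is a non-forking extension of the type `p` over `A`:
`p ⊆ q` and both have the same Morley rank. -/
def IsNonforkingExtension {A B : Set U} (hAB : A ⊆ B) {n : ℕ} (p : TypesOver L A n)
    (q : TypesOver L B n) : Prop :=
  (∀ φ : L[[A]].Formula (Fin n), Formula.equivSentence φ ∈ p →
    Formula.equivSentence ((L.lhomWithConstantsMap (Set.inclusion hAB)).onFormula φ) ∈ q) ∧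
  typeRank q = typeRank p

variable (L)

/-- `A` is independent from `B` over `C`: for every finite tuple `a` of elements of `A`,
`tp(a / C ∪ B)` is a non-forking extension of `tp(a / C)`. -/
def ForkIndep [Nonempty U] (A C B : Set U) : Prop :=
  ∀ (n : ℕ) (a : Fin n → U), (∀ i, a i ∈ A) →
    IsNonforkingExtension (L := L) (Set.subset_union_left : C ⊆ C ∪ B) (tp L C a) (tp L (C ∪ B) a)

variable {L}

/-- The forking dependence relation on the finite subsets of `M`, for `M` elementarily embedded in
the monster model `U`: `x ⇒ y` iff `y` is independent from `y` over `x`. -/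
def ForkDep [Nonempty U] {M : Type w'} [L.Structure M] (i : M ↪ₑ[L] U) (x y : Finset M) : Prop :=
  ForkIndep L (i '' (y : Set M)) (i '' (x : Set M)) (i '' (y : Set M))

end Forking

end

end AtomicDependence

open AtomicDependence

/-!
An element of a set `b` has Morley rank zero over any parameter set containing `b`, because it
satisfies a formula with only one solution. Hence `b` is independent from itself over `a` exactly if
all finite tuples from `b` have a type of Morley rank zero over `a`
(`AtomicDependence.forkIndep_self_iff`). A definable set has rank at most zero iff it is finite
(`morleyRank_le_zero_iff`), so a tuple has a type of rank zero over `a` iff it lies in a finite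
`a`-definable set. This is algebraicity over `a` in the monster model, and it agrees with
algebraicity in `M` since having at least `k` solutions is expressed by a formula
(`map_mem_acl_iff`). Consequently `x ⇒ y` means `y ⊆ acl x`, and (D1)–(D4) say that `acl` is a
closure operator; the only non-trivial point is its idempotence (`acl_subset_acl_of_subset`).

Soundness of the rules is an induction on derivations. For completeness, let `=(x, y)` be entailed,
let `c ∈ acl ∅` and `d ∉ acl ∅`. Send a variable `v` to `c` if `=(x, v)` is derivable, and to `d`
otherwise. All hypotheses hold under this assignment, hence so does `=(x, y)`. As `x` is mapped into
`acl ∅`, so is `y`, which means that `=(x, v)` is derivable for every `v` in `y`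
(`Derivable.of_entails`).

The `ℵ₀`-saturated elementary extension is an ultrapower over a non-principal ultrafilter on `ℕ`:
since the language is countable, such ultrapowers realize all types over finite sets
(`isAleph0Saturated_ultrapower`).
-/

namespace AtomicDependence

/-! ### Dependence atoms: soundness and canonical assignments -/

section Atoms

variable {V : Type x} {S : Set (DepAtom V)}

theorem Derivable.entails {φ : DepAtom V} (h : Derivable S φ) (C : Set DependenceStructure.{w}) :
    Entails C S φ := by
  classical
  intro D _ s hs
  have hR := D.isDep
  unfold DependenceStructure.Satisfies at hs ⊢
  induction h with
  | hyp h => exact hs _ h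
  | a1 x => exact hR.d1 _
  | b1 h h' _ ih =>
    simp only [List.map_append, List.toFinset_append] at ih ⊢
    convert! hR.d2 _ _ _ _ (by convert! ih)
  | c1 _ _ _ _ _ ih₁ ih₂ => exact hR.d3 _ _ _ ih₁ ih₂
  | d1 _ _ _ _ _ ih₁ ih₂ =>
    simp only [List.map_append, List.toFinset_append] at ih₁ ih₂ ⊢
    convert! hR.d4 _ _ _ ih₁ ih₂
  | e1 _ _ hp _ ih =>
    simp only [List.toFinset_eq_of_perm _ _ (hp.map s)] at ih ⊢
    exact ih

/-- `=(x, v)` is derivable for each single entry `v` of `x`. -/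
theorem Derivable.of_mem {l : List V} {v : V} (hv : v ∈ l) :
    Derivable S ⟨l, [v], fun _ => by simp⟩ := by
  classical
  have hp : l.Perm (v :: l.erase v) := List.perm_cons_erase hv
  -- The rule (b1) only extracts initial segments of the right-hand side, so `v` is first moved to
  -- the front on both sides.
  refine Derivable.e1 (fun _ => by simp) (fun _ => by simp) hp ?_
  have h := Derivable.b1 (S := S) (x := v :: l.erase v) (y := [v]) (z := l.erase v) (u := [])
    (fun _ => by simp) (fun _ => by simp) (Derivable.a1 (v :: l.erase v))
  simpa using h

theorem Derivable.rhs_mem {x y : List V} {h : x ≠ [] → y ≠ []} (hd : Derivable S ⟨x, y, h⟩)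
    {v : V} (hv : v ∈ y) : Derivable S ⟨x, [v], fun _ => by simp⟩ :=
  Derivable.c1 h (fun _ => by simp) _ hd (Derivable.of_mem hv)

theorem Derivable.of_forall_mem {x : List V} : ∀ {y : List V} (h : x ≠ [] → y ≠ []), y ≠ [] →
    (∀ v ∈ y, Derivable S ⟨x, [v], fun _ => by simp⟩) → Derivable S ⟨x, y, h⟩
  | [], _, hy, _ => absurd rfl hy
  | [v], _, _, hd => hd v (by simp)
  | v :: v' :: l, _, _, hd =>
    Derivable.d1 (y := [v]) (v := v' :: l) (fun _ => by simp) (fun _ => by simp) _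
      (hd v (by simp)) (Derivable.of_forall_mem (fun _ => by simp) (by simp)
        fun a ha => hd a (by simp [List.mem_cons.1 ha]))

/-- Weakening of an atom with empty left-hand side. -/
theorem Derivable.of_nil {v : V} (x : List V)
    (hd : Derivable S ⟨[], [v], fun _ => by simp⟩) : Derivable S ⟨x, [v], fun _ => by simp⟩ :=
  Derivable.b1 (x := []) (y := [v]) (z := []) (u := x) (fun _ => by simp) (fun _ => by simp) hd

open Classical in
/-- Completeness with respect to a single dependence structure whose relation has the form
`x ⇒ y ↔ y ⊆ cl x`, where `cl` behaves like a closure operator with `cl ∅ ≠ ∅` and `cl ∅ ≠ I`. For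
the atom `=(x, y)`, the variables determined by `x` are sent to a fixed element of `cl ∅` and all
others to a fixed element outside of `cl ∅`. -/
theorem Derivable.of_entails {C : Set DependenceStructure.{w}} {D : DependenceStructure.{w}}
    (hD : D ∈ C) (cl : Set D.I → Set D.I)
    (hrel : ∀ x y : Finset D.I, D.rel x y ↔ ∀ c ∈ y, c ∈ cl (x : Set D.I))
    (hmono : Monotone cl) (hsub : ∀ x : Finset D.I, (x : Set D.I) ⊆ cl x)
    (hidem : ∀ x : Finset D.I, (x : Set D.I) ⊆ cl ∅ → cl x ⊆ cl ∅)
    (hne : cl ∅ ≠ ∅) (huniv : cl ∅ ≠ Set.univ) {φ : DepAtom V} (h : Entails C S φ) :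
    Derivable S φ := by
  obtain ⟨c, hc⟩ := Set.nonempty_iff_ne_empty.2 hne
  obtain ⟨d, hd⟩ := (Set.ne_univ_iff_exists_notMem _).1 huniv
  obtain ⟨x, y, hxy⟩ := φ
  let K : Set V := {v | Derivable S ⟨x, [v], fun _ => by simp⟩}
  let s : V → D.I := fun v => if v ∈ K then c else d
  have hsK : ∀ v, s v ∈ cl ∅ ↔ v ∈ K := fun v => by
    by_cases hv : v ∈ K <;> simp [s, hv, hc, hd]
  have hS : ∀ ψ ∈ S, D.Satisfies s ψ := by
    rintro ⟨a, b, hab⟩ hψ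
    refine (hrel _ _).2 fun e he => ?_
    simp only [List.mem_toFinset, List.mem_map] at he
    obtain ⟨v, hv, rfl⟩ := he
    by_cases haK : ∀ t ∈ a, t ∈ K
    · refine hmono (Set.empty_subset _) ((hsK v).2 ?_)
      have hab' : Derivable S ⟨a, [v], fun _ => by simp⟩ := (Derivable.hyp hψ).rhs_mem hv
      by_cases ha : a = []
      · subst ha
        exact hab'.of_nil x
      · exact Derivable.c1 (fun _ => ha) (fun _ => by simp) _
          (Derivable.of_forall_mem (fun _ => ha) ha haK) hab'
    · push Not at haK
      obtain ⟨t, ht, htK⟩ := haK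
      by_cases hvK : v ∈ K
      · exact hmono (Set.empty_subset _) ((hsK v).2 hvK)
      · refine hsub _ ?_
        simp only [List.coe_toFinset, List.mem_map, Set.mem_ofPred_eq]
        exact ⟨t, ht, by simp [s, htK, hvK]⟩
  have hφ := (hrel _ _).1 (h D hD s hS)
  by_cases hy : y = []
  · have hx : x = [] := by
      by_contra hx
      exact hxy hx hy
    subst hy hx
    exact Derivable.a1 []
  · refine Derivable.of_forall_mem hxy hy fun v hv => (hsK v).1 (hidem _ ?_ (hφ (s v) ?_))
    · intro e he
      simp only [List.coe_toFinset, List.mem_map, Set.mem_ofPred_eq] at he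
      obtain ⟨t, ht, rfl⟩ := he
      exact (hsK t).2 (Derivable.of_mem ht)
    · simpa using ⟨v, hv, rfl⟩

end Atoms

/-! ### Algebraic closure -/

section Acl

variable {L : FirstOrder.Language.{u, v}}

/-- The formula `χ(v)` expressing that there are at least `k` solutions `x` of `φ(v, x)`. -/
noncomputable def atLeastFormula {α : Type*} (φ : L.Formula (α ⊕ Fin 1)) (k : ℕ) : L.Formula α :=
  ((Formula.iInf fun j : Fin k => φ.relabel (Sum.map id fun _ => j)) ⊓
    Formula.iInf fun p : {p : Fin k × Fin k // p.1 ≠ p.2} =>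
      ((Term.var (Sum.inr p.1.1)).equal (Term.var (Sum.inr p.1.2)) :
        L.Formula (α ⊕ Fin k)).not).iExs (Fin k)

theorem realize_atLeastFormula {M : Type w} [L.Structure M] {α : Type*}
    (φ : L.Formula (α ⊕ Fin 1)) (k : ℕ) (v : α → M) :
    (atLeastFormula φ k).Realize v ↔ ∃ f : Fin k → M, Function.Injective f ∧
      ∀ j, φ.Realize (Sum.elim v fun _ => f j) := by
  have h (f : Fin k → M) (j : Fin k) :
      Sum.elim v f ∘ Sum.map id (fun _ : Fin 1 => j) = Sum.elim v fun _ => f j := by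
    ext a
    rcases a with a | a <;> rfl
  simp only [atLeastFormula, Formula.realize_iExs, Formula.realize_inf, Formula.realize_iInf,
    Formula.realize_relabel, h, Formula.realize_not, Formula.realize_equal, Term.realize_var,
    Sum.elim_inr, Subtype.forall, Prod.forall]
  refine exists_congr fun f => and_comm.trans (and_congr_left fun _ => ?_)
  exact ⟨fun h a b hab => by_contra fun hne => h a b hne hab, fun h a b hne hab => hne (h hab)⟩

theorem finite_iff_exists_not_injective {M : Type w} {s : Set M} :
    s.Finite ↔ ∃ k : ℕ, ¬∃ f : Fin k → M, Function.Injective f ∧ ∀ j, f j ∈ s := by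
  constructor
  · intro hs
    refine ⟨s.ncard + 1, fun ⟨f, hf, hfs⟩ => ?_⟩
    have h := Set.ncard_le_ncard (Set.range_subset_iff.2 hfs) hs
    rw [Set.ncard_range_of_injective hf] at h
    simp at h
  · rintro ⟨k, hk⟩
    by_contra hs
    have : Infinite s := Set.infinite_coe_iff.2 hs
    exact hk ⟨fun j => Infinite.natEmbedding s j, fun a b hab => Fin.ext
      ((Infinite.natEmbedding s).injective (Subtype.ext hab)), fun j => Subtype.property _⟩

theorem finite_setOf_realize_iff {M : Type w} [L.Structure M] {α : Type*}
    {φ : L.Formula (α ⊕ Fin 1)} {v : α → M} :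
    {x | φ.Realize (Sum.elim v fun _ => x)}.Finite ↔ ∃ k, ¬(atLeastFormula φ k).Realize v := by
  simp only [finite_iff_exists_not_injective, realize_atLeastFormula, Set.mem_ofPred_eq]

theorem definable_setOf_realize {M : Type w} [L.Structure M] (A : Set M) {α : Type*}
    (φ : L.Formula α) : A.Definable L {v : α → M | φ.Realize v} :=
  (Set.empty_definable_iff.2 ⟨φ, rfl⟩).mono (Set.empty_subset A)

theorem mem_acl_iff {M : Type w} [L.Structure M] {A : Set M} {c : M} :
    c ∈ acl L A ↔ ∃ φ : L.Formula (A ⊕ Fin 1), φ.Realize (Sum.elim (↑) fun _ => c) ∧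
      {x | φ.Realize (Sum.elim (fun a : A => (a : M)) fun _ => x)}.Finite := by
  have hc (y : Fin 1 → M) : (fun _ => y 0) = y := funext fun j => by rw [Subsingleton.elim j 0]
  constructor
  · rintro ⟨X, hX, hfin, hcX⟩
    obtain ⟨φ, hφ⟩ := Set.definable_iff_exists_formula_sum.1 hX
    have h (y : M) : φ.Realize (Sum.elim (↑) fun _ => y) ↔ y ∈ X :=
      (Set.ext_iff.1 hφ fun _ => y).symm
    exact ⟨φ, (h c).2 hcX, by simpa only [h, Set.ofPred_mem_eq] using hfin⟩
  · rintro ⟨φ, hφ, hfin⟩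
    refine ⟨_, Set.definable_iff_exists_formula_sum.2 ⟨φ, ?_⟩, hfin, hφ⟩
    ext y
    simp only [Set.mem_ofPred_eq, hc]

/-- An element which satisfies, together with a tuple of elements of `A`, a formula with finitely
many solutions is algebraic over `A`. -/
theorem mem_acl_of_realize {M : Type w} [L.Structure M] {A : Set M} {α : Type*} {v : α → M}
    (hv : ∀ a, v a ∈ A) {φ : L.Formula (α ⊕ Fin 1)} {c : M}
    (hc : φ.Realize (Sum.elim v fun _ => c))
    (hfin : {x | φ.Realize (Sum.elim v fun _ => x)}.Finite) : c ∈ acl L A := by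
  let g : α → A := fun a => ⟨v a, hv a⟩
  have h (y : M) : (φ.relabel (Sum.map g id)).Realize (Sum.elim (↑) fun _ => y) ↔
      φ.Realize (Sum.elim v fun _ => y) := by
    rw [Formula.realize_relabel, Sum.elim_comp_map]
    rfl
  exact mem_acl_iff.2 ⟨φ.relabel (Sum.map g id), (h c).2 hc, by simpa only [h] using hfin⟩

theorem acl_mono {M : Type w} [L.Structure M] : Monotone (acl L : Set M → Set M) :=
  fun _ _ h _ ⟨X, hX, hfin, hc⟩ => ⟨X, hX.mono h, hfin, hc⟩

theorem subset_acl {M : Type w} [L.Structure M] (A : Set M) : A ⊆ acl L A :=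
  fun c hc => ⟨{c}, Set.Definable.singleton_of_mem L hc, Set.finite_singleton c, rfl⟩

/-- If `b` is one of fewer than `k` solutions of `φ(B, x)` and each element `y` of `B` lies in a
finite `A`-definable set `Y y`, then the set of solutions of all those `φ(w, x)` with `w` in the
product of the sets `Y y` and fewer than `k` solutions is finite, `A`-definable, and contains
`b`. -/
theorem acl_subset_acl_of_subset {M : Type w} [L.Structure M] {A B : Set M} (hB : B.Finite)
    (h : B ⊆ acl L A) : acl L B ⊆ acl L A := by
  intro b hb
  have := hB.to_subtype
  obtain ⟨φ, hφ, hfin⟩ := mem_acl_iff.1 hb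
  obtain ⟨k, hk⟩ := finite_setOf_realize_iff.1 hfin
  choose Y hYdef hYfin hYmem using fun y : B => h y.2
  let P : Set (B → M) := {w | (∀ y, w y ∈ Y y) ∧ ¬(atLeastFormula φ k).Realize w}
  have hP : P.Finite := (Set.Finite.pi' hYfin).subset fun w hw => hw.1
  have hPdef : A.Definable L P := by
    refine Set.Definable.inter (f := {w | ∀ y, w y ∈ Y y}) ?_
      (definable_setOf_realize A (atLeastFormula φ k)).compl
    rw [Set.ofPred_forall]
    exact Set.definable_iInter_of_finite fun y => (hYdef y).preimage_comp fun _ => y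
  refine ⟨⋃ w ∈ P, {x | φ.Realize (Sum.elim w fun _ => x)}, ?_,
    hP.biUnion fun w hw => finite_setOf_realize_iff.2 ⟨k, hw.2⟩,
    Set.mem_biUnion (show (fun y : B => (y : M)) ∈ P from ⟨hYmem, hk⟩) hφ⟩
  have hdef := Set.Definable.exists_of_finite (α := Fin 1) (β := B)
    ((hPdef.preimage_comp Sum.inr).inter
      ((definable_setOf_realize A φ).preimage_comp (Sum.swap : B ⊕ Fin 1 → Fin 1 ⊕ B)))
  unfold Set.Definable₁
  convert! hdef using 1
  ext y
  have hy : (fun _ => y 0) = y := funext fun j => by rw [Subsingleton.elim j 0]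
  simp [hy]

theorem realize_elim_comp_map {M : Type w} [L.Structure M] {U : Type w'} [L.Structure U]
    (i : M ↪ₑ[L] U) {α : Type*} (φ : L.Formula (α ⊕ Fin 1)) (v : α → M) (y : M) :
    φ.Realize (Sum.elim (i ∘ v) fun _ => i y) ↔ φ.Realize (Sum.elim v fun _ => y) := by
  rw [← i.map_formula, Sum.comp_elim]
  rfl

theorem map_mem_acl_iff {M : Type w} [L.Structure M] {U : Type w'} [L.Structure U]
    (i : M ↪ₑ[L] U) {A : Set M} {c : M} : i c ∈ acl L (i '' A) ↔ c ∈ acl L A := by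
  constructor
  · intro h
    obtain ⟨φ, hφ, hfin⟩ := mem_acl_iff.1 h
    choose v hvA hv using fun a : i '' A => a.2
    have hv' : ((↑) : i '' A → U) = i ∘ v := funext fun a => (hv a).symm
    rw [hv'] at hφ hfin
    refine mem_acl_of_realize hvA ((realize_elim_comp_map i φ v c).1 hφ) ?_
    simp only [← realize_elim_comp_map i]
    exact hfin.preimage i.injective.injOn
  · intro h
    obtain ⟨φ, hφ, hfin⟩ := mem_acl_iff.1 h
    refine mem_acl_of_realize (v := i ∘ ((↑) : A → M)) (fun a => Set.mem_image_of_mem i a.2)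
      ((realize_elim_comp_map i φ _ c).2 hφ) ?_
    -- A bound for the number of solutions in `M` is also one for the number of solutions in `U`.
    obtain ⟨k, hk⟩ := finite_setOf_realize_iff.1 hfin
    exact finite_setOf_realize_iff.2 ⟨k, by rwa [i.map_formula]⟩

end Acl

/-! ### Morley rank zero and forking -/

section Rank

variable {L : FirstOrder.Language.{u, v}} {U : Type w} [L.Structure U] {n : ℕ}

theorem morleyRankGE_zero {X : Set (Fin n → U)} : MorleyRankGE L 0 X ↔ X.Nonempty := by
  rw [MorleyRankGE, Ordinal.limitRecOn_zero]

theorem morleyRankGE_add_one {α : Ordinal.{w}} {X : Set (Fin n → U)} :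
    MorleyRankGE L (α + 1) X ↔ ∃ Y : ℕ → Set (Fin n → U),
      (∀ i, (Set.univ : Set U).Definable L (Y i)) ∧ (∀ i, Y i ⊆ X) ∧
        (∀ i j, i ≠ j → Disjoint (Y i) (Y j)) ∧ ∀ i, MorleyRankGE L α (Y i) := by
  unfold MorleyRankGE
  rw [Ordinal.limitRecOn_add_one]

theorem morleyRankGE_limit {δ : Ordinal.{w}} (hδ : Order.IsSuccLimit δ) {X : Set (Fin n → U)} :
    MorleyRankGE L δ X ↔ ∀ β < δ, MorleyRankGE L β X := by
  unfold MorleyRankGE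
  rw [Ordinal.limitRecOn_limit _ _ _ _ hδ]

theorem MorleyRankGE.nonempty {α : Ordinal.{w}} {X : Set (Fin n → U)} (h : MorleyRankGE L α X) :
    X.Nonempty := by
  induction α using Ordinal.limitRecOn generalizing X with
  | zero => exact morleyRankGE_zero.1 h
  | add_one α ih =>
    obtain ⟨Y, -, hYX, -, hY⟩ := morleyRankGE_add_one.1 h
    exact (ih (hY 0)).mono (hYX 0)
  | limit δ hδ _ => exact morleyRankGE_zero.1 ((morleyRankGE_limit hδ).1 h 0 hδ.bot_lt)

theorem MorleyRankGE.infinite {α : Ordinal.{w}} (hα : α ≠ 0) {X : Set (Fin n → U)}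
    (h : MorleyRankGE L α X) : X.Infinite := by
  induction α using Ordinal.limitRecOn generalizing X with
  | zero => exact absurd rfl hα
  | add_one α _ =>
    obtain ⟨Y, -, hYX, hdisj, hY⟩ := morleyRankGE_add_one.1 h
    choose f hf using fun i => (hY i).nonempty
    refine Set.infinite_of_injective_forall_mem (f := f) (fun i j hij => ?_) fun i => hYX i (hf i)
    by_contra hne
    exact Set.disjoint_left.1 (hdisj i j hne) (hf i) (hij ▸ hf j)
  | limit δ hδ ih =>
    have h1 : (1 : Ordinal.{w}) < δ := Ordinal.one_lt_of_isSuccLimit hδ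
    exact ih 1 h1 one_ne_zero ((morleyRankGE_limit hδ).1 h 1 h1)

theorem definable_singleton (x : Fin n → U) :
    (Set.univ : Set U).Definable L ({x} : Set (Fin n → U)) := by
  have h : ({x} : Set (Fin n → U)) = ⋂ j, {y | y j ∈ ({x j} : Set U)} := by
    ext y
    simp [funext_iff]
  rw [h]
  exact Set.definable_iInter_of_finite fun j =>
    (Set.Definable.singleton_of_mem L (Set.mem_univ (x j))).preimage_comp fun _ => j

theorem morleyRankGE_one_of_infinite {X : Set (Fin n → U)} (hX : X.Infinite) :
    MorleyRankGE L 1 X := by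
  rw [← zero_add (1 : Ordinal.{w}), morleyRankGE_add_one]
  have := hX.to_subtype
  refine ⟨fun k => {(Infinite.natEmbedding X k : Fin n → U)}, fun k => definable_singleton _,
    fun k => Set.singleton_subset_iff.2 (Subtype.property _), fun i j hij => ?_,
    fun k => morleyRankGE_zero.2 (Set.singleton_nonempty _)⟩
  rw [Set.disjoint_singleton]
  exact fun h => hij ((Infinite.natEmbedding X).injective (Subtype.ext h))

theorem le_morleyRank {α : Ordinal.{w}} {X : Set (Fin n → U)} (h : MorleyRankGE L α X) :
    ((α : WithTop Ordinal.{w}) : WithBot (WithTop Ordinal.{w})) ≤ morleyRank L X :=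
  le_sSup ⟨α, h, rfl⟩

theorem zero_le_morleyRank {X : Set (Fin n → U)} (h : X.Nonempty) : 0 ≤ morleyRank L X :=
  le_morleyRank (morleyRankGE_zero.2 h)

theorem morleyRank_le_zero_iff {X : Set (Fin n → U)} : morleyRank L X ≤ 0 ↔ X.Finite := by
  constructor
  · intro h
    by_contra hX
    have h1 := (le_morleyRank (morleyRankGE_one_of_infinite (L := L) hX)).trans h
    exact absurd h1 (not_le.2 (WithBot.coe_lt_coe.2 (WithTop.coe_lt_coe.2 zero_lt_one)))
  · intro h
    refine sSup_le ?_
    rintro _ ⟨α, hα, rfl⟩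
    have h0 : α = 0 := by
      by_contra hne
      exact hα.infinite hne h
    rw [h0]
    exact le_rfl

variable [Nonempty U]

theorem zero_le_typeRank_tp (A : Set U) (a : Fin n → U) : 0 ≤ typeRank (tp L A a) := by
  refine le_sInf ?_
  rintro _ ⟨φ, hφ, rfl⟩
  exact zero_le_morleyRank ⟨a, Theory.CompleteType.formula_mem_typeOf.1 hφ⟩

theorem typeRank_tp_le_zero_iff {A : Set U} {a : Fin n → U} :
    typeRank (tp L A a) ≤ 0 ↔ ∃ X : Set (Fin n → U), A.Definable L X ∧ X.Finite ∧ a ∈ X := by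
  constructor
  · intro h
    have h1 : typeRank (tp L A a) < ((1 : Ordinal.{w}) : WithTop Ordinal.{w}) :=
      h.trans_lt (WithBot.coe_lt_coe.2 (WithTop.coe_lt_coe.2 zero_lt_one))
    obtain ⟨_, ⟨φ, hφ, rfl⟩, hlt⟩ := sInf_lt_iff.1 h1
    refine ⟨_, ⟨φ, rfl⟩, ?_, Theory.CompleteType.formula_mem_typeOf.1 hφ⟩
    by_contra hX
    exact hlt.not_ge (le_morleyRank (morleyRankGE_one_of_infinite hX))
  · rintro ⟨_, ⟨φ, rfl⟩, hfin, ha⟩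
    exact sInf_le_of_le ⟨φ, Theory.CompleteType.formula_mem_typeOf.2 ha, rfl⟩
      (morleyRank_le_zero_iff.2 hfin)

/-- A tuple of elements algebraic over `A` lies in the product of finite `A`-definable sets. -/
theorem typeRank_tp_le_zero_of_mem_acl {A : Set U} {a : Fin n → U} (h : ∀ j, a j ∈ acl L A) :
    typeRank (tp L A a) ≤ 0 := by
  choose Y hYdef hYfin hYmem using h
  refine typeRank_tp_le_zero_iff.2 ⟨{x | ∀ j, x j ∈ Y j}, ?_, Set.Finite.pi' hYfin, hYmem⟩
  rw [Set.ofPred_forall]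
  exact Set.definable_iInter_of_finite fun j => (hYdef j).preimage_comp fun _ => j

theorem mem_acl_of_typeRank_tp_le_zero {A : Set U} {c : U}
    (h : typeRank (tp L A fun _ : Fin 1 => c) ≤ 0) : c ∈ acl L A := by
  obtain ⟨X, hX, hfin, hc⟩ := typeRank_tp_le_zero_iff.1 h
  have hconst (y : Fin 1 → U) : (fun _ => y 0) = y :=
    funext fun j => by rw [Subsingleton.elim j 0]
  refine ⟨{y | (fun _ => y) ∈ X}, ?_, hfin.preimage (fun _ _ _ _ h => congrFun h 0), hc⟩
  unfold Set.Definable₁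
  simpa only [Set.mem_ofPred_eq, hconst, Set.ofPred_mem_eq] using hX

/-- A tuple from `B` has rank zero over `C ∪ B`; so `B` is independent from itself over `C`
exactly if all finite tuples from `B` have rank zero over `C`. -/
theorem forkIndep_self_iff {B C : Set U} : ForkIndep L B C B ↔ B ⊆ acl L C := by
  have hBC : B ⊆ acl L (C ∪ B) := Set.subset_union_right.trans (subset_acl _)
  constructor
  · intro h c hc
    refine mem_acl_of_typeRank_tp_le_zero ?_
    rw [← (h 1 (fun _ => c) fun _ => hc).2]
    exact typeRank_tp_le_zero_of_mem_acl fun _ => hBC hc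
  · intro h n a ha
    refine ⟨fun φ hφ => ?_, ?_⟩
    · refine Theory.CompleteType.formula_mem_typeOf.2 ?_
      rw [LHom.realize_onFormula]
      exact Theory.CompleteType.formula_mem_typeOf.1 hφ
    · rw [(typeRank_tp_le_zero_of_mem_acl fun j => h (ha j)).antisymm (zero_le_typeRank_tp _ _),
        (typeRank_tp_le_zero_of_mem_acl fun j => hBC (ha j)).antisymm (zero_le_typeRank_tp _ _)]

theorem forkDep_iff {M : Type w'} [L.Structure M] (i : M ↪ₑ[L] U) (x y : Finset M) :
    ForkDep i x y ↔ ∀ c ∈ y, c ∈ acl L (x : Set M) := by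
  rw [ForkDep, forkIndep_self_iff, Set.image_subset_iff]
  exact forall₂_congr fun _ _ => map_mem_acl_iff i

theorem isDependenceRelation_forkDep {M : Type w'} [L.Structure M] (i : M ↪ₑ[L] U) :
    IsDependenceRelation (ForkDep i) where
  d1 x := (forkDep_iff i x x).2 fun _ hc => subset_acl _ hc
  d2 x y z t h := by
    classical
    simp only [forkDep_iff, Finset.mem_union] at h ⊢
    exact fun c hc => acl_mono (by simp) (h c (Or.inl hc))
  d3 x y z h₁ h₂ := by
    rw [forkDep_iff] at h₁ h₂ ⊢
    exact fun c hc => acl_subset_acl_of_subset y.finite_toSet h₁ (h₂ c hc)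
  d4 x y z h₁ h₂ := by
    rw [forkDep_iff] at h₁ h₂ ⊢
    classical
    intro c hc
    exact (Finset.mem_union.1 hc).elim (h₁ c) (h₂ c)

end Rank

/-! ### Saturated elementary extensions -/

section Saturation

open Filter

/-- The diagonal argument behind the saturation of ultrapowers over `ℕ`: if any finitely many of
the conditions `Q 0, Q 1, …` are simultaneously satisfiable at almost every index, then some choice
of `g i` satisfies each single condition at almost every index `i`. -/
theorem exists_forall_eventually {Y : Type*} [Nonempty Y] {u : Filter ℕ} (hu : u ≤ atTop)
    {Q : ℕ → ℕ → Y → Prop} (h : ∀ k, ∀ᶠ i in u, ∃ y, ∀ j ≤ k, Q j i y) :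
    ∃ g : ℕ → Y, ∀ j, ∀ᶠ i in u, Q j i (g i) := by
  classical
  -- `g i` satisfies at `i` as many of the first `i + 1` conditions as possible.
  have hg (i : ℕ) : ∃ y : Y, ∀ k ≤ i, (∃ y', ∀ j ≤ k, Q j i y') → ∀ j ≤ k, Q j i y := by
    by_cases h0 : ∃ k ≤ i, ∃ y', ∀ j ≤ k, Q j i y'
    · obtain ⟨k₀, hk₀, h₀⟩ := h0
      obtain ⟨y, hy⟩ := Nat.findGreatest_spec (P := fun k => ∃ y', ∀ j ≤ k, Q j i y') hk₀ h₀
      exact ⟨y, fun k hk hex j hj => hy j (hj.trans (Nat.le_findGreatest hk hex))⟩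
    · exact ⟨Classical.arbitrary Y, fun k hk hex => absurd ⟨k, hk, hex⟩ h0⟩
  choose g hg using hg
  refine ⟨g, fun j => ?_⟩
  filter_upwards [h j, hu (eventually_ge_atTop j)] with i hi hji
  exact hg i j hji hi j le_rfl

variable {L : FirstOrder.Language.{u, v}}

/-- Any finitely many formulas of a complete type over a subset of a structure `M` are
simultaneously satisfied in `M`. -/
theorem exists_forall_realize_of_mem {M : Type w} [L.Structure M] [Nonempty M] {α : Type*}
    [Finite α] (p : (L.completeTheory M).CompleteType α) {ι : Type*} [Finite ι]
    (φ : ι → L.Formula α) (hφ : ∀ j, Formula.equivSentence (φ j) ∈ p) :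
    ∃ x : α → M, ∀ j, (φ j).Realize x := by
  obtain ⟨N, y, hy⟩ := Theory.exists_modelType_is_realized_in _ p
  let σ : L.Sentence := ((Formula.iInf φ).relabel (Sum.inr : α → Empty ⊕ α)).iExs α
  have hσM : M ⊨ σ ↔ ∃ x : α → M, ∀ j, (φ j).Realize x := by
    simp [σ, Sentence.Realize, Formula.realize_iExs, Formula.realize_relabel]
  have hσN : N ⊨ σ ↔ ∃ x : α → N, ∀ j, (φ j).Realize x := by
    simp [σ, Sentence.Realize, Formula.realize_iExs, Formula.realize_relabel]
  by_contra hM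
  rw [← hσM] at hM
  have hN : N ⊨ σ.not := (L.completeTheory M).realize_sentence_of_mem
    (mem_completeTheory.2 ((Sentence.realize_not M).2 hM))
  refine (Sentence.realize_not N).1 hN ((hσN).2 ⟨y, fun j => ?_⟩)
  exact Theory.CompleteType.formula_mem_typeOf.1 (hy ▸ hφ j)

theorem realize_constantsVarsEquiv {M : Type w} [L.Structure M] {A : Set M} {α : Type*}
    (φ : L[[A]].Formula α) (x : α → M) :
    Formula.Realize (BoundedFormula.constantsVarsEquiv φ : L.Formula (A ⊕ α))
      (Sum.elim (fun a : A => (a : M)) x) ↔ φ.Realize x :=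
  BoundedFormula.realize_constantsVarsEquiv

variable (L)

/-- The diagonal embedding into an ultrapower is elementary, by Łoś's theorem. -/
noncomputable def ultrapowerEmbedding {ι : Type*} (u : Ultrafilter ι) (M : Type w) [L.Structure M]
    [Nonempty M] : M ↪ₑ[L] (u : Filter ι).Product fun _ => M where
  toFun m := ((fun _ => m : ι → M) : (u : Filter ι).Product fun _ => M)
  map_formula' _ φ v := by
    refine (Ultraproduct.realize_formula_cast φ fun k _ => v k).trans ?_
    simp

theorem isAleph0Saturated_ultrapower (hL : L.card ≤ Cardinal.aleph0) (M : Type w) [L.Structure M]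
    [Nonempty M] :
    IsAleph0Saturated L ((hyperfilter ℕ : Filter ℕ).Product fun _ => M) := by
  intro A hA n p
  have : Countable L.Symbols := Cardinal.mk_le_aleph0_iff.1 hL
  have : Countable A := hA.countable.to_subtype
  let P : Set (L[[A]].Formula (Fin n)) := {φ | Formula.equivSentence φ ∈ p}
  have hP : Nonempty P := by
    rcases p.mem_or_not_mem (Formula.equivSentence ⊤) with h | h
    · exact ⟨⟨⊤, h⟩⟩
    · exact ⟨⟨Formula.equivSentence.symm _, by simpa [P] using h⟩⟩
  obtain ⟨e, he⟩ := exists_surjective_nat P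
  let ψ : ℕ → L.Formula (A ⊕ Fin n) := fun j => BoundedFormula.constantsVarsEquiv (e j).1
  let mk : (ℕ → M) → (hyperfilter ℕ : Filter ℕ).Product fun _ => M := fun f => f
  have hmk : Function.Surjective mk := Quot.exists_rep
  choose rep hrep using hmk
  have key (j : ℕ) (x : Fin n → ℕ → M) : (e j).1.Realize (fun l => mk (x l)) ↔
      ∀ᶠ i in (hyperfilter ℕ : Filter ℕ),
        (ψ j).Realize (Sum.elim (fun a : A => rep a i) fun l => x l i) := by
    have h1 : Sum.elim (fun a : A => (a : (hyperfilter ℕ : Filter ℕ).Product fun _ => M))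
        (fun l => mk (x l)) = fun b => mk (Sum.elim (fun a : A => rep a) x b) := by
      ext b
      rcases b with b | b
      · exact (hrep _).symm
      · rfl
    have h2 (i : ℕ) : Sum.elim (fun a : A => rep a i) (fun l => x l i) =
        fun b => Sum.elim (fun a : A => rep a) x b i := by
      ext b
      rcases b with b | b <;> rfl
    rw [← realize_constantsVarsEquiv, h1]
    simp only [h2]
    exact Ultraproduct.realize_formula_cast _ _
  obtain ⟨g, hg⟩ := exists_forall_eventually (Y := Fin n → M) (u := hyperfilter ℕ)
    (Nat.hyperfilter_le_atTop)
    (Q := fun j i y => (ψ j).Realize (Sum.elim (fun a : A => rep a i) y)) fun k => by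
      obtain ⟨x, hx⟩ := exists_forall_realize_of_mem p (fun j : Fin (k + 1) => (e j).1)
        fun j => (e j).2
      have hx' : ∀ j : Fin (k + 1), ∀ᶠ i in (hyperfilter ℕ : Filter ℕ),
          (ψ j).Realize (Sum.elim (fun a : A => rep a i) fun l => rep (x l) i) := by
        intro j
        rw [← key]
        simpa only [hrep] using hx j
      filter_upwards [eventually_all.2 hx'] with i hi
      exact ⟨_, fun j hj => hi ⟨j, Nat.lt_succ_of_le hj⟩⟩
  refine ⟨fun l => mk fun i => g i l, ?_⟩
  -- By maximality of complete types, one inclusion suffices.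
  have hle : ∀ σ ∈ p, σ ∈ tp L A fun l => mk fun i => g i l := by
    intro σ hσ
    obtain ⟨φ, rfl⟩ := Formula.equivSentence.surjective σ
    obtain ⟨j, hj⟩ := he ⟨φ, hσ⟩
    refine Theory.CompleteType.formula_mem_typeOf.2 ?_
    have := (key j fun l i => g i l).2 (hg j)
    rwa [hj] at this
  refine SetLike.ext fun σ => ⟨fun hσ => ?_, hle σ⟩
  by_contra hσ'
  exact (Theory.CompleteType.not_mem_iff _ σ).1 (hle _ ((p.not_mem_iff σ).2 hσ')) hσ

end Saturation

end AtomicDependence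

theorem mainTheorem6 {L : FirstOrder.Language.{u, v}} (T : L.Theory) (hT : IsOmegaStable T)
    (M : Theory.ModelType.{u, v, w} T) :
    (∃ U : Theory.ModelType.{u, v, w} T, IsAleph0Saturated L U ∧ Nonempty (M ↪ₑ[L] U)) ∧
    ∀ (U : Theory.ModelType.{u, v, w'} T) (_ : IsAleph0Saturated L U) (i : M ↪ₑ[L] U),
      (∀ a b : Finset M,
        ForkIndep L (i '' (b : Set M)) (i '' (a : Set M)) (i '' (b : Set M)) ↔
          ∀ c ∈ b, c ∈ acl L (a : Set M)) ∧
      ∃ hD : IsDependenceRelation (ForkDep i),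
        ∀ C : Set DependenceStructure.{w},
          DependenceStructure.mk M (ForkDep i) hD ∈ C →
          acl L (∅ : Set M) ≠ ∅ → acl L (∅ : Set M) ≠ Set.univ →
          ∀ (V : Type x) (S : Set (DepAtom V)) (φ : DepAtom V),
            Derivable S φ ↔ Entails C S φ := by
  refine ⟨?_, fun U _ i => ⟨fun a b => forkDep_iff i a b, isDependenceRelation_forkDep i, ?_⟩⟩
  · let E := ultrapowerEmbedding L (Filter.hyperfilter ℕ) M
    have : ((Filter.hyperfilter ℕ : Filter ℕ).Product fun _ => M) ⊨ T :=
      E.theory_model_iff T |>.1 inferInstance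
    exact ⟨Theory.ModelType.of T ((Filter.hyperfilter ℕ : Filter ℕ).Product fun _ => M),
      isAleph0Saturated_ultrapower L hT.countable_language M, ⟨E⟩⟩
  · intro C hC hne huniv V S φ
    exact ⟨fun h => h.entails C, Derivable.of_entails hC (acl L) (forkDep_iff i) acl_mono
      (fun x => subset_acl (x : Set M))
      (fun x hx => acl_subset_acl_of_subset x.finite_toSet hx) hne huniv⟩
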